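/- For $u\in L^2(-1,1)$, $i\in\{1,2\}$ and $\lambda,\lambda_1,\lambda_2>0$ let $$\mathrm{TV}^i_{\lambda}(u)=\sup\Big\{\int_{-1}^1 u\,\phi^{(i)}\,dx:\ \phi\in C_c^\infty(-1,1),\ \|\phi\|_{L^\infty}\le\lambda\Big\},$$ $$\mathrm{TGV}_{\lambda_1,\lambda_2}(u)=\sup\Big\{\int_{-1}^1 u\,\phi''\,dx:\ \phi\in C_c^\infty(-1,1),\ \|\phi'\|_{L^\infty}\le\lambda_1,\ \|\phi\|_{L^\infty}\le\lambda_2\Big\}.$$ Let $u^\delta(x)=|x|-\tfrac12$ on $(-1,1)$, and consider on $L^2(-1,1)$ the functionals $$\mathcal F^i_\lambda(u)=\tfrac12\int_{-1}^1(u-u^\delta)^2\,dx+\mathrm{TV}^i_\lambda(u),\qquad \mathcal G_{\lambda_1,\lambda_2}(u)=\tfrac12\int_{-1}^1(u-u^\delta)^2\,dx+\mathrm{TGV}_{\lambda_1,\lambda_2}(u).$$ Write $\sigma^1[f](x)=\int_{-1}^x f(t)\,dt$ and $\sigma^2[f](x)=\int_{-1}^x\sigma^1[f](t)\,dt$. Let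 $\Lambda$ be the set of pairs $(\lambda_1,\lambda_2)$ with $\lambda_1,\lambda_2>0$ such that, for the minimizer $u_1$ of $\mathcal F^1_{\lambda_1}$ and the minimizer $u_2$ of $\mathcal F^2_{\lambda_2}$, $$\lambda_1<\|\sigma^1[u_2-u^\delta]\|_{L^\infty(-1,1)}\quad\text{and}\quad \lambda_2<\|\sigma^2[u_1-u^\delta]\|_{L^\infty(-1,1)}.$$ For real $c,d$ put $$w(x,c,d)=\begin{cases} d|x|+c(1-d)-\tfrac12, & |x|\le c,\\ |x|-\tfrac12, & c<|x|\le 1-c,\\ d|x|+c(d-1)-d+\tfrac12, & |x|>1-c.\end{cases}$$ **Theorem.** Let $(\lambda_1,\lambda_2)\in\Lambda$ and $$c=\frac{3(\lambda_1-\lambda_2)}{2\lambda_1},\qquad d=1-\frac89\,\frac{\lambda_1^3}{(\lambda_2-\lambda_1)^2}.$$ Then $c\in[0,\tfrac12]$, $d\in[0,1]$, and $w(\cdot,c,d)$ is the unique minimizer of $\mathcal G_{\lambda_1,\lambda_2}$ in $L^2(-1,1)$. Moreover, with $$\mu_1=\frac98\,\frac{(\lambda_1-\lambda_2)^2}{\lambda_1^2}\in(0,\tfrac18],\qquad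 \mu_2=\frac2{27}\,\frac{\lambda_1^3}{(\lambda_1-\lambda_2)^2}\in(0,\tfrac1{12}],$$ the functionals $\mathcal F^1_{\mu_1}$ and $\mathcal F^2_{\mu_2}$ have unique minimizers $v_1$ and $v_2$ in $L^2(-1,1)$, and $$w(\cdot,c,d)=12\,\mu_2\,v_1+v_2 .$$ -/

import Mathlib

open MeasureTheory Set
open scoped ENNReal ContDiff

namespace TGV

/-- Lebesgue measure on the open interval `(-1, 1)`. -/
noncomputable abbrev leb : Measure ℝ := volume.restrict (Ioo (-1 : ℝ) 1)

/-- The space `L²(-1, 1)`. -/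
abbrev L2 : Type := Lp ℝ 2 leb

/-- The test functions `C_c^∞(-1, 1)`, extended by zero to the real line. -/
def testFunctions : Set (ℝ → ℝ) :=
  {φ | ContDiff ℝ ∞ φ ∧ HasCompactSupport φ ∧ tsupport φ ⊆ Ioo (-1 : ℝ) 1}

/-- `TV_l^i (u)`, the supremum of `∫ u φ^(i)` over the test functions with `‖φ‖_∞ ≤ l`. -/
noncomputable def tv (i : ℕ) (l : ℝ) (u : L2) : EReal :=
  ⨆ φ ∈ {φ : ℝ → ℝ | φ ∈ testFunctions ∧ ∀ x, |φ x| ≤ l},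
    ((∫ x, u x * iteratedDeriv i φ x ∂leb : ℝ) : EReal)

/-- `TGV_{l₁, l₂} (u)`, the supremum of `∫ u φ''` over the test functions with
`‖φ'‖_∞ ≤ l₁` and `‖φ‖_∞ ≤ l₂`. -/
noncomputable def tgv (l₁ l₂ : ℝ) (u : L2) : EReal :=
  ⨆ φ ∈ {φ : ℝ → ℝ | φ ∈ testFunctions ∧ (∀ x, |deriv φ x| ≤ l₁) ∧ ∀ x, |φ x| ≤ l₂},
    ((∫ x, u x * iteratedDeriv 2 φ x ∂leb : ℝ) : EReal)

/-- The quadratic fidelity term `½ ∫ (u - g)²` for data `g`. -/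
noncomputable def fidelity (g : ℝ → ℝ) (u : L2) : ℝ :=
  1 / 2 * ∫ x, (u x - g x) ^ 2 ∂leb

/-- The functional of `L²`-`TV^i` regularization with data `g` and parameter `l`. -/
noncomputable def tvFunctional (g : ℝ → ℝ) (i : ℕ) (l : ℝ) (u : L2) : EReal :=
  (fidelity g u : EReal) + tv i l u

/-- The functional of `L²`-`TGV` regularization with data `g` and parameters `l₁, l₂`. -/
noncomputable def tgvFunctional (g : ℝ → ℝ) (l₁ l₂ : ℝ) (u : L2) : EReal :=
  (fidelity g u : EReal) + tgv l₁ l₂ u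

/-- The iterated primitives `σ^i[f]`: `σ^0[f] = f`, `σ^{i+1}[f](x) = ∫_{-1}^x σ^i[f]`. -/
noncomputable def sigma : ℕ → (ℝ → ℝ) → ℝ → ℝ
  | 0, f => f
  | i + 1, f => fun x => ∫ t in (-1 : ℝ)..x, sigma i f t

/-- The norm `‖σ^i[u - g]‖` in `L^∞(-1, 1)`; here `u - g` is the dual variable of `u`. -/
noncomputable def dualSigmaNorm (g : ℝ → ℝ) (i : ℕ) (u : L2) : ℝ≥0∞ :=
  eLpNorm (sigma i fun x => u x - g x) ∞ leb

/-- The parameter region `Λ` for data `g`: with `u₁` the minimizer of the `TV¹` functional with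
parameter `l₁` and `u₂` the minimizer of the `TV²` functional with parameter `l₂`,
`l₁ < ‖σ¹[u₂ - g]‖_∞` and `l₂ < ‖σ²[u₁ - g]‖_∞`. -/
def Lambda (g : ℝ → ℝ) : Set (ℝ × ℝ) :=
  {l | 0 < l.1 ∧ 0 < l.2 ∧ ∃ u₁ u₂ : L2,
    IsMinOn (tvFunctional g 1 l.1) univ u₁ ∧ IsMinOn (tvFunctional g 2 l.2) univ u₂ ∧
    ENNReal.ofReal l.1 < dualSigmaNorm g 1 u₂ ∧ ENNReal.ofReal l.2 < dualSigmaNorm g 2 u₁}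

/-- The data `u^δ(x) = |x| - 1/2`. -/
noncomputable def absData (x : ℝ) : ℝ := |x| - 1 / 2

/-- The two-parameter family `w(x, c, d)` of piecewise affine functions. -/
noncomputable def w (x c d : ℝ) : ℝ :=
  if |x| ≤ c then d * |x| + c * (1 - d) - 1 / 2
  else if |x| ≤ 1 - c then absData x
  else d * |x| + c * (d - 1) - d + 1 / 2

end TGV

namespace TGV

/-! Each regularizer `J` is a support function: `J v` is a supremum of `∫ v p` over derivatives `p`
of test functions. So `u` is the minimizer once its residual `p = u^δ - u` satisfies `∫ v p ≤ J v`
for all `v` and `J u ≤ ∫ u p`; completing the square gives uniqueness as well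
(`isMinOn_fidelity_add_iff`).

One family of residuals serves all three functionals. Let `r_c` be `u^δ` minus its clip to `[c -
1/2, 1/2 - c]`. By `w_eq`, `w(·, c, d)` is `(1 - d)` times the clip plus `d u^δ`, so its residual is
`(1 - d) r_c`. For `TV¹` the minimizer is a clip, with residual `r_c`; for `TV²` it is `d u^δ`, with
residual `(1 - d) r_{1/2}`, because the clip at `c = 1/2` is zero. The first two primitives of `r_c`
vanish outside `(-1, 1)` and are bounded by `c²/2` and `c²/2 - c³/3`. Mollifying them
(`exists_testFunction_seq`) shows that `k r_c` is a limit of admissible second derivatives whenever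
`k` times these bounds respects the constraints. Conversely, pairing a piecewise affine function
with a second derivative only evaluates at its kinks, which bounds `J u` from above.

For TGV the two sides agree when both constraints are tight: `(1 - d) c²/2 = λ₁` and `(1 - d)(c²/2 -
c³/3) = λ₂`. The quotient gives `1 - 2c/3 = λ₂/λ₁`, hence the stated `c` and `d`. Then `μ₁ = c²/2`
and `12 μ₂ = 1 - d`, so `v₁` is the clip, `v₂ = d u^δ`, and the final identity is `w_eq`. Since the
TV minimizers are explicit, membership in `Λ` turns into polynomial inequalities that put `c` and
`d` in range. -/

/-! ### The residual of the clipped data and its primitives as sums of truncated powers. -/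

/-- The data `|x| - 1/2`, clipped to the interval `[c - 1/2, 1/2 - c]`. -/
noncomputable def clippedAbs (c x : ℝ) : ℝ :=
  1 / 2 - c + 1 / 2 * (|x + c| + |x - c| - |x + 1 - c| - |x - 1 + c|)

/-- The residual of the clipped data on `(-1, 1)`, extended by zero. -/
noncomputable def residual (c : ℝ) : ℝ → ℝ :=
  (Ioo (-1 : ℝ) 1).indicator fun x => absData x - clippedAbs c x

/-- The compactly supported primitive of `residual c`. -/
noncomputable def residualPrim (c x : ℝ) : ℝ :=
  c * max (x + 1) 0 - max (x + 1) 0 ^ 2 / 2 + max (x + 1 - c) 0 ^ 2 / 2 - max (x + c) 0 ^ 2 / 2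
    + max x 0 ^ 2 - max (x - c) 0 ^ 2 / 2 + max (x - 1 + c) 0 ^ 2 / 2 - max (x - 1) 0 ^ 2 / 2
    - c * max (x - 1) 0

/-- The compactly supported second primitive of `residual c`. -/
noncomputable def residualPrim₂ (c x : ℝ) : ℝ :=
  c * (max (x + 1) 0 ^ 2 / 2) - max (x + 1) 0 ^ 3 / 6 + max (x + 1 - c) 0 ^ 3 / 6
    - max (x + c) 0 ^ 3 / 6 + max x 0 ^ 3 / 3 - max (x - c) 0 ^ 3 / 6
    + max (x - 1 + c) 0 ^ 3 / 6 - max (x - 1) 0 ^ 3 / 6 - c * (max (x - 1) 0 ^ 2 / 2)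

theorem hasDerivAt_max_zero_pow (n : ℕ) (x : ℝ) :
    HasDerivAt (fun y : ℝ => max y 0 ^ (n + 2)) ((n + 2) * max x 0 ^ (n + 1)) x := by
  rcases lt_trichotomy x 0 with hx | rfl | hx
  · rw [max_eq_right hx.le, zero_pow (by omega), mul_zero]
    refine (hasDerivAt_const x (0 : ℝ)).congr_of_eventuallyEq ?_
    filter_upwards [gt_mem_nhds hx] with y hy
    rw [max_eq_right (le_of_lt hy), zero_pow (by omega)]
  -- At the kink the function is bounded by `|y| ^ (n + 2)`, which is `o(y)` because the exponent is
  -- at least 2.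
  · have h : HasFDerivAt (fun y : ℝ => max y 0 ^ (n + 2)) (0 : ℝ →L[ℝ] ℝ) 0 := by
      refine Asymptotics.IsBigO.hasFDerivAt (n := n + 2) ?_ (by omega)
      refine Asymptotics.IsBigO.of_bound 1 (Filter.Eventually.of_forall fun y => ?_)
      rw [one_mul, norm_pow, norm_pow, norm_norm, sub_zero]
      gcongr
      rw [Real.norm_eq_abs, Real.norm_eq_abs, abs_of_nonneg (le_max_right y 0)]
      exact max_le (le_abs_self y) (abs_nonneg y)
    simpa using h.hasDerivAt
  · rw [max_eq_left hx.le]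
    have h := hasDerivAt_pow (n + 2) x
    have e : n + 2 - 1 = n + 1 := by omega
    rw [e] at h
    push_cast at h
    refine h.congr_of_eventuallyEq ?_
    filter_upwards [lt_mem_nhds hx] with y hy
    rw [max_eq_left (le_of_lt hy)]

theorem hasDerivAt_max_add_zero_pow (n : ℕ) (a x : ℝ) :
    HasDerivAt (fun y : ℝ => max (y + a) 0 ^ (n + 2)) ((n + 2) * max (x + a) 0 ^ (n + 1)) x :=
  (hasDerivAt_max_zero_pow n (x + a)).comp_add_const x a

theorem hasDerivAt_residualPrim₂ (c x : ℝ) :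
    HasDerivAt (residualPrim₂ c) (residualPrim c x) x := by
  have h2 := fun a => hasDerivAt_max_add_zero_pow 0 a x
  have h3 := fun a => hasDerivAt_max_add_zero_pow 1 a x
  have h := (((((((((h2 1).div_const 2).const_mul c).sub ((h3 1).div_const 6)).add
    ((h3 (1 - c)).div_const 6)).sub ((h3 c).div_const 6)).add ((h3 0).div_const 3)).sub
    ((h3 (-c)).div_const 6)).add ((h3 (-1 + c)).div_const 6)).sub ((h3 (-1)).div_const 6)|>.sub
    (((h2 (-1)).div_const 2).const_mul c)
  refine (h.congr_of_eventuallyEq (.of_forall fun y => ?_)).congr_deriv ?_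
  · simp only [residualPrim₂, Pi.add_apply, Pi.sub_apply]
    ring_nf
  · simp only [residualPrim]
    push_cast
    ring_nf

theorem max_zero_eq (y : ℝ) : max y 0 = (|y| + y) / 2 := by
  rcases le_total 0 y with h | h
  · rw [max_eq_left h, abs_of_nonneg h]; ring
  · rw [max_eq_right h, abs_of_nonpos h]; ring

theorem residualPrim_eq_zero {c x : ℝ} (hc : c ∈ Icc (0 : ℝ) (1 / 2)) (hx : x ≤ -1 ∨ 1 ≤ x) :
    residualPrim c x = 0 := by
  obtain ⟨h0, h1⟩ := hc
  unfold residualPrim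
  rcases hx with hx | hx
  · repeat rw [max_eq_right (by linarith)]
    ring
  · repeat rw [max_eq_left (by linarith)]
    ring

theorem residualPrim₂_eq_zero {c x : ℝ} (hc : c ∈ Icc (0 : ℝ) (1 / 2)) (hx : x ≤ -1 ∨ 1 ≤ x) :
    residualPrim₂ c x = 0 := by
  obtain ⟨h0, h1⟩ := hc
  unfold residualPrim₂
  rcases hx with hx | hx
  · repeat rw [max_eq_right (by linarith)]
    ring
  · repeat rw [max_eq_left (by linarith)]
    ring

theorem continuous_residualPrim (c : ℝ) : Continuous (residualPrim c) := by
  unfold residualPrim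
  fun_prop

theorem continuous_residualPrim₂ (c : ℝ) : Continuous (residualPrim₂ c) := by
  unfold residualPrim₂
  fun_prop

theorem continuous_absData : Continuous absData := by
  unfold absData
  fun_prop

theorem continuous_clippedAbs (c : ℝ) : Continuous (clippedAbs c) := by
  unfold clippedAbs
  fun_prop

theorem hasDerivAt_residualPrim {c x : ℝ} (hc : c ∈ Icc (0 : ℝ) (1 / 2))
    (hx : x ∉ ({-1, 1} : Set ℝ)) : HasDerivAt (residualPrim c) (residual c x) x := by
  simp only [mem_insert_iff, mem_singleton_iff, not_or] at hx
  rcases lt_or_gt_of_ne hx.1 with h1 | h1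
  · rw [residual, indicator_of_notMem (by simp; intro; linarith)]
    refine (hasDerivAt_const x (0 : ℝ)).congr_of_eventuallyEq ?_
    filter_upwards [gt_mem_nhds h1] with y hy
    exact residualPrim_eq_zero hc (Or.inl (le_of_lt hy))
  rcases lt_or_gt_of_ne hx.2 with h2 | h2
  · rw [residual, indicator_of_mem (show x ∈ Ioo (-1 : ℝ) 1 from ⟨h1, h2⟩)]
    have hp := fun a => hasDerivAt_max_add_zero_pow 0 a x
    have hl : HasDerivAt (fun y : ℝ => c * (y + 1) - (y + 1) ^ 2 / 2) (c - (x + 1)) x := by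
      have h := (((hasDerivAt_id x).add_const 1).const_mul c).sub
        ((((hasDerivAt_id x).add_const 1).pow 2).div_const 2)
      refine h.congr_deriv ?_
      simp
    have h := (((((hl.add ((hp (1 - c)).div_const 2)).sub ((hp c).div_const 2)).add (hp 0)).sub
      ((hp (-c)).div_const 2)).add ((hp (-1 + c)).div_const 2))
    refine (h.congr_of_eventuallyEq (f₁ := residualPrim c) ?_).congr_deriv ?_
    rotate_left
    · simp only [absData, clippedAbs, zero_add, pow_one, max_zero_eq]
      push_cast
      ring_nf
    · filter_upwards [lt_mem_nhds h1, gt_mem_nhds h2] with y hy1 hy2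
      simp only [residualPrim, Pi.add_apply, Pi.sub_apply]
      rw [max_eq_left (by linarith : 0 ≤ y + 1), max_eq_right (by linarith : y - 1 ≤ 0)]
      ring_nf
  · rw [residual, indicator_of_notMem (by simp; intro; linarith)]
    refine (hasDerivAt_const x (0 : ℝ)).congr_of_eventuallyEq ?_
    filter_upwards [lt_mem_nhds h2] with y hy
    exact residualPrim_eq_zero hc (Or.inr (le_of_lt hy))

/-! ### Values of the clip and the decomposition of `w`. -/

theorem clippedAbs_of_abs_le {c x : ℝ} (hc : c ∈ Icc (0 : ℝ) (1 / 2)) (hx : |x| ≤ c) :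
    clippedAbs c x = c - 1 / 2 := by
  obtain ⟨h0, h1⟩ := hc
  obtain ⟨h2, h3⟩ := abs_le.1 hx
  rw [clippedAbs, abs_of_nonneg (by linarith : 0 ≤ x + c), abs_of_nonpos (by linarith : x - c ≤ 0),
    abs_of_nonneg (by linarith : 0 ≤ x + 1 - c), abs_of_nonpos (by linarith : x - 1 + c ≤ 0)]
  ring

theorem clippedAbs_of_le_abs_of_abs_le {c x : ℝ} (hc : c ∈ Icc (0 : ℝ) (1 / 2)) (hx : c ≤ |x|)
    (hx' : |x| ≤ 1 - c) : clippedAbs c x = absData x := by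
  obtain ⟨h0, h1⟩ := hc
  unfold clippedAbs absData
  rcases le_total 0 x with h | h
  · rw [abs_of_nonneg h] at *
    rw [abs_of_nonneg (by linarith : 0 ≤ x + c), abs_of_nonneg (by linarith : 0 ≤ x - c),
      abs_of_nonneg (by linarith : 0 ≤ x + 1 - c), abs_of_nonpos (by linarith : x - 1 + c ≤ 0)]
    ring
  · rw [abs_of_nonpos h] at *
    rw [abs_of_nonpos (by linarith : x + c ≤ 0), abs_of_nonpos (by linarith : x - c ≤ 0),
      abs_of_nonneg (by linarith : 0 ≤ x + 1 - c), abs_of_nonpos (by linarith : x - 1 + c ≤ 0)]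
    ring

theorem clippedAbs_of_le_abs {c x : ℝ} (hc : c ∈ Icc (0 : ℝ) (1 / 2)) (hx : 1 - c ≤ |x|) :
    clippedAbs c x = 1 / 2 - c := by
  obtain ⟨h0, h1⟩ := hc
  unfold clippedAbs
  rcases le_total 0 x with h | h
  · rw [abs_of_nonneg h] at *
    rw [abs_of_nonneg (by linarith : 0 ≤ x + c), abs_of_nonneg (by linarith : 0 ≤ x - c),
      abs_of_nonneg (by linarith : 0 ≤ x + 1 - c), abs_of_nonneg (by linarith : 0 ≤ x - 1 + c)]
    ring
  · rw [abs_of_nonpos h] at *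
    rw [abs_of_nonpos (by linarith : x + c ≤ 0), abs_of_nonpos (by linarith : x - c ≤ 0),
      abs_of_nonpos (by linarith : x + 1 - c ≤ 0), abs_of_nonpos (by linarith : x - 1 + c ≤ 0)]
    ring

theorem w_eq {c : ℝ} (hc : c ∈ Icc (0 : ℝ) (1 / 2)) (d x : ℝ) :
    w x c d = (1 - d) * clippedAbs c x + d * absData x := by
  unfold w
  split_ifs with h1 h2
  · rw [clippedAbs_of_abs_le hc h1, absData]; ring
  · rw [clippedAbs_of_le_abs_of_abs_le hc (not_le.1 h1).le h2]; ring
  · rw [clippedAbs_of_le_abs hc (not_le.1 h2).le, absData]; ring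

theorem abs_residual_le {c : ℝ} (hc : c ∈ Icc (0 : ℝ) (1 / 2)) (x : ℝ) : |residual c x| ≤ c := by
  unfold residual
  by_cases hx : x ∈ Ioo (-1 : ℝ) 1
  · rw [indicator_of_mem hx]
    have h3 : |x| ≤ 1 := (abs_lt.2 hx).le
    have h4 := abs_nonneg x
    rcases le_total |x| c with h1 | h1
    · rw [clippedAbs_of_abs_le hc h1, absData]
      exact abs_le.2 ⟨by linarith, by linarith [hc.1]⟩
    rcases le_total |x| (1 - c) with h2 | h2
    · rw [clippedAbs_of_le_abs_of_abs_le hc h1 h2, sub_self, abs_zero]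
      exact hc.1
    · rw [clippedAbs_of_le_abs hc h2, absData]
      exact abs_le.2 ⟨by linarith [hc.1], by linarith⟩
  · rw [indicator_of_notMem hx, abs_zero]
    exact hc.1

theorem measurable_residual (c : ℝ) : Measurable (residual c) :=
  (continuous_absData.sub (continuous_clippedAbs c)).measurable.indicator measurableSet_Ioo

theorem continuousAt_residual (c : ℝ) {x : ℝ} (hx : x ∈ Ioo (-1 : ℝ) 1) :
    ContinuousAt (residual c) x := by
  refine (continuous_absData.sub (continuous_clippedAbs c)).continuousAt.congr ?_
  filter_upwards [isOpen_Ioo.mem_nhds hx] with y hy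
  rw [residual, indicator_of_mem hy]
  rfl

/-! ### Symmetry, uniform bounds and kink values of the primitives. -/

theorem residualPrim_neg {c : ℝ} (x : ℝ) : residualPrim c (-x) = -residualPrim c x := by
  have h : ∀ y : ℝ, max (-y) 0 = max y 0 - y := fun y => by
    rw [max_zero_eq, max_zero_eq, abs_neg]; ring
  unfold residualPrim
  rw [show -x + 1 - c = -(x - 1 + c) by ring, show -x - 1 + c = -(x + 1 - c) by ring,
    show -x + 1 = -(x - 1) by ring, show -x - 1 = -(x + 1) by ring,
    show -x + c = -(x - c) by ring, show -x - c = -(x + c) by ring]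
  simp only [h]
  have hs : ∀ y : ℝ, max y 0 ^ 2 = y * max y 0 := fun y => by
    rcases le_total 0 y with h | h
    · rw [max_eq_left h]; ring
    · rw [max_eq_right h]; ring
  simp only [sub_sq, hs]
  ring

theorem residualPrim_mem_Icc_of_nonneg {c x : ℝ} (hc : c ∈ Icc (0 : ℝ) (1 / 2)) (hx : 0 ≤ x) :
    residualPrim c x ∈ Icc (-(c ^ 2 / 2)) 0 := by
  rcases le_total 1 x with h1 | h1
  · rw [residualPrim_eq_zero hc (Or.inr h1)]
    exact ⟨by nlinarith [sq_nonneg c], le_rfl⟩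
  obtain ⟨hc0, hc1⟩ := hc
  have e : residualPrim c x = max (c - x) 0 ^ 2 / 2 - c ^ 2 / 2 + max (x - 1 + c) 0 ^ 2 / 2 := by
    unfold residualPrim
    rw [max_eq_left (by linarith : 0 ≤ x + 1), max_eq_left (by linarith : 0 ≤ x + 1 - c),
      max_eq_left (by linarith : 0 ≤ x + c), max_eq_left hx, max_eq_right (by linarith : x - 1 ≤ 0)]
    rcases le_total x c with h | h
    · rw [max_eq_right (by linarith : x - c ≤ 0), max_eq_left (by linarith : 0 ≤ c - x)]; ring
    · rw [max_eq_left (by linarith : 0 ≤ x - c), max_eq_right (by linarith : c - x ≤ 0)]; ring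
  rw [e]
  constructor
  · nlinarith [sq_nonneg (max (c - x) 0), sq_nonneg (max (x - 1 + c) 0)]
  · rcases le_total x c with h | h
    · rw [max_eq_right (by linarith : x - 1 + c ≤ 0), max_eq_left (by linarith : 0 ≤ c - x)]
      nlinarith
    · rw [max_eq_right (by linarith : c - x ≤ 0)]
      have : max (x - 1 + c) 0 ≤ c := max_le (by linarith) hc0
      nlinarith [le_max_right (x - 1 + c) 0]

theorem residualPrim_mem_Icc_of_nonpos {c x : ℝ} (hc : c ∈ Icc (0 : ℝ) (1 / 2)) (hx : x ≤ 0) :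
    residualPrim c x ∈ Icc 0 (c ^ 2 / 2) := by
  have h := residualPrim_mem_Icc_of_nonneg hc (neg_nonneg.2 hx)
  rw [residualPrim_neg] at h
  exact ⟨by linarith [h.2], by linarith [h.1]⟩

theorem abs_residualPrim_le {c : ℝ} (hc : c ∈ Icc (0 : ℝ) (1 / 2)) (x : ℝ) :
    |residualPrim c x| ≤ c ^ 2 / 2 := by
  rcases le_total 0 x with hx | hx
  · have h := residualPrim_mem_Icc_of_nonneg hc hx
    exact abs_le.2 ⟨h.1, by nlinarith [h.2]⟩
  · have h := residualPrim_mem_Icc_of_nonpos hc hx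
    exact abs_le.2 ⟨by nlinarith [h.1], h.2⟩

theorem residualPrim₂_zero {c : ℝ} (hc : c ∈ Icc (0 : ℝ) (1 / 2)) :
    residualPrim₂ c 0 = c ^ 2 / 2 - c ^ 3 / 3 := by
  obtain ⟨hc0, hc1⟩ := hc
  unfold residualPrim₂
  rw [max_eq_left (by linarith : (0 : ℝ) ≤ 0 + 1), max_eq_left (by linarith : 0 ≤ 0 + 1 - c),
    max_eq_left (by linarith : 0 ≤ 0 + c), max_self, max_eq_right (by linarith : 0 - c ≤ 0),
    max_eq_right (by linarith : 0 - 1 + c ≤ 0), max_eq_right (by linarith : (0 : ℝ) - 1 ≤ 0)]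
  ring

/-- The first primitive is nonnegative on the left half-line and nonpositive on the right one, so
the second primitive rises from zero to its value at the origin and falls back to zero. -/
theorem abs_residualPrim₂_le {c : ℝ} (hc : c ∈ Icc (0 : ℝ) (1 / 2)) (x : ℝ) :
    |residualPrim₂ c x| ≤ c ^ 2 / 2 - c ^ 3 / 3 := by
  have hd : ∀ y, deriv (residualPrim₂ c) y = residualPrim c y := fun y =>
    (hasDerivAt_residualPrim₂ c y).deriv
  have hm : MonotoneOn (residualPrim₂ c) (Iic 0) := by
    refine monotoneOn_of_deriv_nonneg (convex_Iic 0) (continuous_residualPrim₂ c).continuousOn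
      (fun y _ => (hasDerivAt_residualPrim₂ c y).differentiableAt.differentiableWithinAt)
      fun y hy => ?_
    rw [interior_Iic] at hy
    rw [hd]
    exact (residualPrim_mem_Icc_of_nonpos hc (le_of_lt hy)).1
  have ha : AntitoneOn (residualPrim₂ c) (Ici 0) := by
    refine antitoneOn_of_deriv_nonpos (convex_Ici 0) (continuous_residualPrim₂ c).continuousOn
      (fun y _ => (hasDerivAt_residualPrim₂ c y).differentiableAt.differentiableWithinAt)
      fun y hy => ?_
    rw [interior_Ici] at hy
    rw [hd]
    exact (residualPrim_mem_Icc_of_nonneg hc (le_of_lt hy)).2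
  rw [← residualPrim₂_zero hc]
  rcases le_total 0 x with hx | hx
  · have h1 := ha (mem_Ici.2 le_rfl) hx hx
    have h2 := ha hx (mem_Ici.2 (by positivity : (0 : ℝ) ≤ x + 1)) (by linarith)
    rw [residualPrim₂_eq_zero hc (Or.inr (by linarith))] at h2
    rwa [abs_of_nonneg h2]
  · have h1 := hm hx (mem_Iic.2 le_rfl) hx
    have h2 := hm (mem_Iic.2 (by linarith : x - 1 ≤ 0)) hx (by linarith)
    rw [residualPrim₂_eq_zero hc (Or.inl (by linarith))] at h2
    rwa [abs_of_nonneg h2]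

/-- This combination of values is what pairing the clip with its own residual produces. -/
theorem residualPrim₂_kinks {c : ℝ} (hc : c ∈ Icc (0 : ℝ) (1 / 2)) :
    residualPrim₂ c c + residualPrim₂ c (-c) - residualPrim₂ c (1 - c)
      - residualPrim₂ c (-1 + c) = 2 * (1 - 2 * c) * (c ^ 2 / 2) := by
  obtain ⟨hc0, hc1⟩ := hc
  have e1 : residualPrim₂ c c = c ^ 2 / 2 - 2 * c ^ 3 / 3 := by
    unfold residualPrim₂
    rw [max_eq_left (by linarith : 0 ≤ c + 1), max_eq_left (by linarith : 0 ≤ c + 1 - c),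
      max_eq_left (by linarith : 0 ≤ c + c), max_eq_left hc0, max_eq_left (by linarith : 0 ≤ c - c),
      max_eq_right (by linarith : c - 1 + c ≤ 0), max_eq_right (by linarith : c - 1 ≤ 0)]
    ring
  have e2 : residualPrim₂ c (-c) = c ^ 2 / 2 - 2 * c ^ 3 / 3 := by
    unfold residualPrim₂
    rw [max_eq_left (by linarith : 0 ≤ -c + 1), max_eq_left (by linarith : 0 ≤ -c + 1 - c),
      max_eq_left (by linarith : 0 ≤ -c + c), max_eq_right (by linarith : -c ≤ 0),
      max_eq_right (by linarith : -c - c ≤ 0),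
      max_eq_right (by linarith : -c - 1 + c ≤ 0), max_eq_right (by linarith : -c - 1 ≤ 0)]
    ring
  have e3 : residualPrim₂ c (1 - c) = c ^ 3 / 3 := by
    unfold residualPrim₂
    rw [max_eq_left (by linarith : 0 ≤ 1 - c + 1), max_eq_left (by linarith : 0 ≤ 1 - c + 1 - c),
      max_eq_left (by linarith : 0 ≤ 1 - c + c), max_eq_left (by linarith : 0 ≤ 1 - c),
      max_eq_left (by linarith : 0 ≤ 1 - c - c),
      max_eq_left (by linarith : 0 ≤ 1 - c - 1 + c), max_eq_right (by linarith : 1 - c - 1 ≤ 0)]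
    ring
  have e4 : residualPrim₂ c (-1 + c) = c ^ 3 / 3 := by
    unfold residualPrim₂
    rw [max_eq_left (by linarith : 0 ≤ -1 + c + 1), max_eq_left (by linarith : 0 ≤ -1 + c + 1 - c),
      max_eq_right (by linarith : -1 + c + c ≤ 0), max_eq_right (by linarith : -1 + c ≤ 0),
      max_eq_right (by linarith : -1 + c - c ≤ 0),
      max_eq_right (by linarith : -1 + c - 1 + c ≤ 0), max_eq_right (by linarith : -1 + c - 1 ≤ 0)]
    ring
  rw [e1, e2, e3, e4]
  ring

/-! ### Approximation of the residual by second derivatives of test functions. -/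

open Filter Topology
open scoped Convolution

/-- The Lipschitz constant dominates the difference quotients, and a countable exceptional set is
null, so the derivative may fall on the nonsmooth factor. -/
theorem hasDerivAt_convolution_of_lipschitzWith {ρ f f' : ℝ → ℝ} {K : NNReal} {s : Set ℝ}
    (hρ : Continuous ρ) (hρc : HasCompactSupport ρ) (hf : LipschitzWith K f)
    (hf' : Measurable f') (hs : s.Countable) (hd : ∀ x ∉ s, HasDerivAt f (f' x) x) (x : ℝ) :
    HasDerivAt (ρ ⋆[ContinuousLinearMap.lsmul ℝ ℝ, volume] f)
      ((ρ ⋆[ContinuousLinearMap.lsmul ℝ ℝ, volume] f') x) x := by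
  have hF : ∀ y, Continuous fun t => ρ t * f (y - t) := fun y =>
    hρ.mul (hf.continuous.comp (continuous_const.sub continuous_id))
  refine (hasDerivAt_integral_of_dominated_loc_of_lip (F := fun y t => ρ t * f (y - t))
    (F' := fun t => ρ t * f' (x - t)) (bound := fun t => ‖ρ t‖ * K) (s := univ) univ_mem
    (.of_forall fun y => (hF y).aestronglyMeasurable)
    ((hF x).integrable_of_hasCompactSupport hρc.mul_right)
    (hρ.measurable.mul (hf'.comp (measurable_const.sub measurable_id))).aestronglyMeasurable
    (.of_forall fun t => ?_)
    ((hρ.integrable_of_hasCompactSupport hρc).norm.mul_const _) ?_).2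
  · refine LipschitzOnWith.of_dist_le_mul fun y _ z _ => ?_
    rw [Real.coe_nnabs, abs_of_nonneg (by positivity), Real.dist_eq, ← mul_sub, abs_mul, mul_assoc]
    refine mul_le_mul_of_nonneg_left ?_ (abs_nonneg _)
    have h := hf.dist_le_mul (y - t) (z - t)
    rwa [dist_sub_right, Real.dist_eq] at h
  · have hn : ((fun t => x - t) ⁻¹' s).Countable :=
      hs.preimage_of_injOn (fun a _ b _ h => sub_right_injective h)
    filter_upwards [hn.ae_notMem volume] with t ht
    exact ((hd (x - t) ht).comp_sub_const x t).const_mul (ρ t)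

theorem abs_convolution_normed_le (ρ : ContDiffBump (0 : ℝ)) {f : ℝ → ℝ} {M : ℝ}
    (hf : Measurable f) (hM : ∀ x, |f x| ≤ M) (x : ℝ) :
    |(ρ.normed volume ⋆[ContinuousLinearMap.lsmul ℝ ℝ, volume] f) x| ≤ M := by
  have h := dist_convolution_le (μ := volume) (g := f) (x₀ := x) (z₀ := (0 : ℝ))
    ((abs_nonneg _).trans (hM 0)) (ρ.support_normed_eq (μ := volume)).subset ρ.nonneg_normed
    ρ.integral_normed hf.aestronglyMeasurable (fun y _ => by simpa using hM y)
  simpa using h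

theorem deriv_mem_testFunctions {φ : ℝ → ℝ} (h : φ ∈ testFunctions) :
    deriv φ ∈ testFunctions :=
  ⟨(contDiff_infty_iff_deriv.1 h.1).2, h.2.1.deriv, (tsupport_deriv_subset).trans h.2.2⟩

theorem intervalIntegrable_residual {c : ℝ} (hc : c ∈ Icc (0 : ℝ) (1 / 2)) (a b : ℝ) :
    IntervalIntegrable (residual c) volume a b := by
  refine IntervalIntegrable.mono_fun (g := residual c) (f := fun _ => c) (by simp)
    (measurable_residual c).aestronglyMeasurable (.of_forall fun x => ?_)
  simpa [abs_of_nonneg hc.1] using abs_residual_le hc x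

theorem integral_residual {c : ℝ} (hc : c ∈ Icc (0 : ℝ) (1 / 2)) (a b : ℝ) :
    ∫ x in a..b, residual c x = residualPrim c b - residualPrim c a := by
  refine integral_eq_of_hasDerivAt_off_countable _ _ (s := {-1, 1}) (Set.to_countable _)
    (continuous_residualPrim c).continuousOn
    (fun x hx => hasDerivAt_residualPrim hc hx.2) (intervalIntegrable_residual hc a b)

theorem lipschitzWith_residualPrim {c : ℝ} (hc : c ∈ Icc (0 : ℝ) (1 / 2)) :
    LipschitzWith c.toNNReal (residualPrim c) := by
  refine LipschitzWith.of_dist_le_mul fun x y => ?_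
  rw [Real.coe_toNNReal c hc.1, Real.dist_eq, Real.dist_eq, ← integral_residual hc]
  exact intervalIntegral.norm_integral_le_of_norm_le_const (f := residual c) (C := c)
    fun z _ => abs_residual_le hc z

/-- Dilation by `t n > 1` pulls the support of the second primitive strictly inside `(-1, 1)`,
leaving room for a mollifier. Neither operation increases the bounds, and continuity of the residual
inside the interval gives the pointwise limit. -/
theorem exists_testFunction_seq {c : ℝ} (hc : c ∈ Icc (0 : ℝ) (1 / 2)) :
    ∃ φ : ℕ → ℝ → ℝ, (∀ n, φ n ∈ testFunctions) ∧
      (∀ n x, |φ n x| ≤ c ^ 2 / 2 - c ^ 3 / 3) ∧ (∀ n x, |deriv (φ n) x| ≤ c ^ 2 / 2) ∧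
      (∀ n x, |deriv (deriv (φ n)) x| ≤ c) ∧
      ∀ x ∈ Ioo (-1 : ℝ) 1,
        Tendsto (fun n => deriv (deriv (φ n)) x) atTop (𝓝 (residual c x)) := by
  set t : ℕ → ℝ := fun n => ((n : ℝ) + 2) / (n + 1) with ht
  have ht1 : ∀ n, 1 ≤ t n := fun n => by
    rw [ht, le_div_iff₀ (by positivity)]; linarith
  have ht0 : ∀ n, 0 < t n := fun n => zero_lt_one.trans_le (ht1 n)
  have htt : Tendsto t atTop (𝓝 1) := by
    have h := (tendsto_one_div_add_atTop_nhds_zero_nat (𝕜 := ℝ)).const_add 1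
    rw [add_zero] at h
    refine h.congr fun n => ?_
    rw [ht]; field_simp; ring
  let ρ : ℕ → ContDiffBump (0 : ℝ) := fun n =>
    ⟨1 / (n + 3) / 2, 1 / (n + 3), by positivity, half_lt_self (by positivity)⟩
  have hρt : Tendsto (fun n => (ρ n).rOut) atTop (𝓝 0) := by
    have h := (tendsto_one_div_add_atTop_nhds_zero_nat (𝕜 := ℝ)).comp (tendsto_add_atTop_nat 2)
    refine h.congr fun n => ?_
    simp only [Function.comp, ρ]
    push_cast
    ring
  -- Dividing by `t n ^ 2` makes the second derivative exactly the dilated residual.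
  let R : ℕ → ℝ → ℝ := fun n x => residualPrim₂ c (x * t n) / t n ^ 2
  let Q : ℕ → ℝ → ℝ := fun n x => residualPrim c (x * t n) / t n
  let P : ℕ → ℝ → ℝ := fun n x => residual c (x * t n)
  have hRQ : ∀ n x, HasDerivAt (R n) (Q n x) x := fun n x => by
    have h := ((hasDerivAt_residualPrim₂ c (x * t n)).comp x
      ((hasDerivAt_id x).mul_const (t n))).div_const (t n ^ 2)
    refine h.congr_deriv ?_
    simp only [Q]
    have := (ht0 n).ne'
    field_simp
  have hQP : ∀ n, ∀ x ∉ (fun x => x * t n) ⁻¹' {-1, 1}, HasDerivAt (Q n) (P n x) x :=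
    fun n x hx => by
      have h := ((hasDerivAt_residualPrim hc hx).comp x
        ((hasDerivAt_id x).mul_const (t n))).div_const (t n)
      refine h.congr_deriv ?_
      simp only [P]
      have := (ht0 n).ne'
      field_simp
  have hcount : ∀ n, ((fun x => x * t n) ⁻¹' ({-1, 1} : Set ℝ)).Countable := fun n =>
    (Set.to_countable _).preimage_of_injOn fun a _ b _ h => mul_left_injective₀ (ht0 n).ne' h
  have hRb : ∀ n x, |R n x| ≤ c ^ 2 / 2 - c ^ 3 / 3 := fun n x => by
    rw [abs_div, abs_of_pos (pow_pos (ht0 n) 2)]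
    exact (div_le_self (abs_nonneg _) (one_le_pow₀ (ht1 n))).trans (abs_residualPrim₂_le hc _)
  have hQb : ∀ n x, |Q n x| ≤ c ^ 2 / 2 := fun n x => by
    rw [abs_div, abs_of_pos (ht0 n)]
    exact (div_le_self (abs_nonneg _) (ht1 n)).trans (abs_residualPrim_le hc _)
  have hPb : ∀ n x, |P n x| ≤ c := fun n x => abs_residual_le hc _
  have hRm : ∀ n, Continuous (R n) := fun n =>
    ((continuous_residualPrim₂ c).comp (continuous_id.mul continuous_const)).div_const _
  have hQm : ∀ n, Continuous (Q n) := fun n =>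
    ((continuous_residualPrim c).comp (continuous_id.mul continuous_const)).div_const _
  have hPm : ∀ n, Measurable (P n) := fun n =>
    (measurable_residual c).comp (measurable_id.mul measurable_const)
  have hRl : ∀ n, LipschitzWith (c ^ 2 / 2).toNNReal (R n) := fun n => by
    refine lipschitzWith_of_nnnorm_deriv_le (fun x => (hRQ n x).differentiableAt) fun x => ?_
    rw [(hRQ n x).deriv, ← NNReal.coe_le_coe, Real.coe_toNNReal _ (by positivity)]
    exact hQb n x
  have hQl : ∀ n, LipschitzWith c.toNNReal (Q n) := fun n => by
    refine LipschitzWith.of_dist_le_mul fun x y => ?_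
    have h := (lipschitzWith_residualPrim hc).dist_le_mul (x * t n) (y * t n)
    have h0 := ht0 n
    simp only [Q, Real.dist_eq, ← sub_div, ← sub_mul, abs_div, abs_mul, abs_of_pos h0] at h ⊢
    rw [div_le_iff₀ h0, mul_assoc]
    exact h
  let φ : ℕ → ℝ → ℝ := fun n =>
    (ρ n).normed volume ⋆[ContinuousLinearMap.lsmul ℝ ℝ, volume] R n
  have hφ1 : ∀ n, deriv (φ n) =
      (ρ n).normed volume ⋆[ContinuousLinearMap.lsmul ℝ ℝ, volume] Q n := fun n => by
    funext x
    exact (hasDerivAt_convolution_of_lipschitzWith (ρ n).continuous_normed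
      (ρ n).hasCompactSupport_normed (hRl n) (hQm n).measurable countable_empty
      (fun y _ => hRQ n y) x).deriv
  have hφ2 : ∀ n, deriv (deriv (φ n)) =
      (ρ n).normed volume ⋆[ContinuousLinearMap.lsmul ℝ ℝ, volume] P n := fun n => by
    rw [hφ1]
    funext x
    exact (hasDerivAt_convolution_of_lipschitzWith (ρ n).continuous_normed
      (ρ n).hasCompactSupport_normed (hQl n) (hPm n) (hcount n) (hQP n) x).deriv
  refine ⟨φ, fun n => ?_, fun n => abs_convolution_normed_le _ (hRm n).measurable (hRb n),
    fun n x => ?_, fun n x => ?_, fun x hx => ?_⟩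
  · have hsm : ContDiff ℝ ∞ (φ n) := (ρ n).hasCompactSupport_normed.contDiff_convolution_left _
      (ρ n).contDiff_normed (hRm n).locallyIntegrable
    -- As `1 / t n = 1 - 1 / (n + 2)`, the mollifier radius `1 / (n + 3)` is smaller than the gap
    -- left by the dilation.
    set b : ℝ := 1 / t n + 1 / (n + 3) with hb
    have hb1 : b < 1 := by
      have : (1 : ℝ) / t n = 1 - 1 / (n + 2) := by
        rw [ht]; field_simp; ring
      have h3 : (1 : ℝ) / (n + 3) < 1 / (n + 2) := by gcongr; norm_num
      rw [hb, this]; linarith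
    have hsub : tsupport (φ n) ⊆ Icc (-b) b := by
      refine closure_minimal ((support_convolution_subset _).trans ?_) isClosed_Icc
      rintro _ ⟨y, hy, z, hz, rfl⟩
      rw [(ρ n).support_normed_eq, Metric.mem_ball, dist_zero_right] at hy
      have hz' : |z| ≤ 1 / t n := by
        by_contra! hlt
        refine hz ?_
        have : residualPrim₂ c (z * t n) = 0 := by
          refine residualPrim₂_eq_zero hc ?_
          rw [div_lt_iff₀ (ht0 n)] at hlt
          rcases abs_cases z with ⟨h, _⟩ | ⟨h, _⟩
          · rw [h] at hlt; exact Or.inr hlt.le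
          · rw [h] at hlt; exact Or.inl (by linarith)
        simp only [R, this, zero_div]
      exact abs_le.1 ((abs_add_le y z).trans (by
        rw [hb, add_comm]; exact add_le_add hz' (le_of_lt hy)))
    refine ⟨hsm, HasCompactSupport.of_support_subset_isCompact isCompact_Icc
      ((subset_tsupport _).trans hsub), hsub.trans fun y hy => ?_⟩
    exact ⟨by linarith [hy.1], by linarith [hy.2]⟩
  · rw [hφ1]
    exact abs_convolution_normed_le _ (hQm n).measurable (hQb n) x
  · rw [hφ2]
    exact abs_convolution_normed_le _ (hPm n) (hPb n) x
  · simp only [hφ2]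
    refine ContDiffBump.convolution_tendsto_right hρt
      (.of_forall fun n => (hPm n).aestronglyMeasurable) ?_ tendsto_const_nhds
    have h1 : Tendsto (fun z : ℕ × ℝ => z.2 * t z.1) (atTop ×ˢ 𝓝 x) (𝓝 x) := by
      have h := (tendsto_snd (f := atTop (α := ℕ)) (g := 𝓝 x)).mul (htt.comp tendsto_fst)
      rwa [mul_one] at h
    exact (continuousAt_residual c hx).tendsto.comp h1

/-! ### Lower bounds for the regularizers. -/

theorem tendsto_integral_mul (u : L2) {c k : ℝ} {f : ℕ → ℝ → ℝ} (hf : ∀ n, Measurable (f n))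
    (hb : ∀ n x, |f n x| ≤ c)
    (hl : ∀ x ∈ Ioo (-1 : ℝ) 1, Tendsto (fun n => f n x) atTop (𝓝 (residual c x))) :
    Tendsto (fun n => ∫ x, u x * (k * f n x) ∂leb) atTop
      (𝓝 (∫ x, u x * (k * residual c x) ∂leb)) := by
  have hu : Integrable u leb := (Lp.memLp u).integrable (by norm_num)
  refine tendsto_integral_of_dominated_convergence (fun x => |u x| * (|k| * c))
    (fun n => hu.aestronglyMeasurable.mul ((hf n).const_mul k).aestronglyMeasurable)
    (hu.abs.mul_const _) (fun n => .of_forall fun x => ?_) ?_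
  · rw [Real.norm_eq_abs, abs_mul, abs_mul]
    exact mul_le_mul_of_nonneg_left (mul_le_mul_of_nonneg_left (hb n x) (abs_nonneg _))
      (abs_nonneg _)
  · filter_upwards [ae_restrict_mem measurableSet_Ioo] with x hx
    exact ((hl x hx).const_mul k).const_mul (u x)

theorem const_mul_mem_testFunctions {φ : ℝ → ℝ} (h : φ ∈ testFunctions) (k : ℝ) :
    (fun x => k * φ x) ∈ testFunctions :=
  ⟨contDiff_const.mul h.1, h.2.1.mul_left,
    (closure_mono (Function.support_mul_subset_right _ _)).trans h.2.2⟩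

theorem deriv_const_mul' (k : ℝ) (φ : ℝ → ℝ) :
    deriv (fun x => k * φ x) = fun x => k * deriv φ x := by
  funext x
  exact deriv_const_mul_field k

/-- The multiples by `k` of the approximating test functions are admissible, and dominated
convergence passes to the limit in the pairing. -/
theorem integral_mul_residual_le_tgv {c k l₁ l₂ : ℝ} (hc : c ∈ Icc (0 : ℝ) (1 / 2)) (hk : 0 ≤ k)
    (h₁ : k * (c ^ 2 / 2) ≤ l₁) (h₂ : k * (c ^ 2 / 2 - c ^ 3 / 3) ≤ l₂) (u : L2) :
    ((∫ x, u x * (k * residual c x) ∂leb : ℝ) : EReal) ≤ tgv l₁ l₂ u := by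
  obtain ⟨φ, hφ, hb0, hb1, hb2, hl⟩ := exists_testFunction_seq hc
  refine le_of_tendsto' ((continuous_coe_real_ereal.tendsto _).comp
    (tendsto_integral_mul u (fun n => ?_) hb2 hl)) fun n => ?_
  · exact (deriv_mem_testFunctions (deriv_mem_testFunctions (hφ n))).1.continuous.measurable
  · refine le_iSup₂_of_le (fun x => k * φ n x)
      ⟨const_mul_mem_testFunctions (hφ n) k, fun x => ?_, fun x => ?_⟩ ?_
    · rw [deriv_const_mul', abs_mul, abs_of_nonneg hk]
      exact (mul_le_mul_of_nonneg_left (hb1 n x) hk).trans h₁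
    · rw [abs_mul, abs_of_nonneg hk]
      exact (mul_le_mul_of_nonneg_left (hb0 n x) hk).trans h₂
    · rw [iteratedDeriv_succ, iteratedDeriv_one, deriv_const_mul', deriv_const_mul']
      rfl

theorem tgv_le_tv_two (l₁ l₂ : ℝ) (u : L2) : tgv l₁ l₂ u ≤ tv 2 l₂ u :=
  iSup₂_le fun φ hφ => le_iSup₂_of_le φ ⟨hφ.1, hφ.2.2⟩ le_rfl

theorem integral_mul_residual_le_tv_two {c k l : ℝ} (hc : c ∈ Icc (0 : ℝ) (1 / 2)) (hk : 0 ≤ k)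
    (h : k * (c ^ 2 / 2 - c ^ 3 / 3) ≤ l) (u : L2) :
    ((∫ x, u x * (k * residual c x) ∂leb : ℝ) : EReal) ≤ tv 2 l u :=
  (integral_mul_residual_le_tgv hc hk le_rfl h u).trans (tgv_le_tv_two _ _ u)

theorem integral_mul_residual_le_tv_one {c l : ℝ} (hc : c ∈ Icc (0 : ℝ) (1 / 2))
    (h : c ^ 2 / 2 ≤ l) (u : L2) :
    ((∫ x, u x * residual c x ∂leb : ℝ) : EReal) ≤ tv 1 l u := by
  obtain ⟨φ, hφ, -, hb1, hb2, hl⟩ := exists_testFunction_seq hc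
  have ht := tendsto_integral_mul u (k := 1)
    (fun n => (deriv_mem_testFunctions (deriv_mem_testFunctions (hφ n))).1.continuous.measurable)
    hb2 hl
  simp only [one_mul] at ht
  refine le_of_tendsto' ((continuous_coe_real_ereal.tendsto _).comp ht) fun n => ?_
  refine le_iSup₂_of_le (deriv (φ n))
    ⟨deriv_mem_testFunctions (hφ n), fun x => (hb1 n x).trans h⟩ ?_
  rw [iteratedDeriv_one]
  rfl

/-! ### Pairing piecewise affine functions with second derivatives. -/

theorem integral_leb (f : ℝ → ℝ) : ∫ x, f x ∂leb = ∫ x in (-1 : ℝ)..1, f x := by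
  rw [intervalIntegral.integral_of_le (by norm_num), integral_Ioc_eq_integral_Ioo]

section Kinks

variable {F f f' : ℝ → ℝ}

/-- Testing `|x - a|` against a second derivative yields point evaluations. -/
theorem integral_abs_sub_mul {a : ℝ} (ha : a ∈ Icc (-1 : ℝ) 1)
    (hF : ∀ x, HasDerivAt F (f x) x) (hf : Continuous f)
    (hd : ∀ x ∈ Ioo (-1 : ℝ) 1, HasDerivAt f (f' x) x) (hi : IntervalIntegrable f' volume (-1) 1)
    (h₁ : f (-1) = 0) (h₂ : f 1 = 0) :
    ∫ x in (-1 : ℝ)..1, |x - a| * f' x = 2 * F a - F 1 - F (-1) := by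
  have hFc : Continuous F := continuous_iff_continuousAt.2 fun x => (hF x).continuousAt
  have hi' : IntervalIntegrable (fun x => |x - a| * f' x) volume (-1) 1 :=
    hi.continuousOn_mul (by fun_prop)
  have ha' : a ∈ uIcc (-1 : ℝ) 1 := by rwa [uIcc_of_le (by norm_num)]
  have hl : IntervalIntegrable (fun x => |x - a| * f' x) volume (-1) a :=
    hi'.mono_set (uIcc_subset_uIcc_left ha')
  have hr : IntervalIntegrable (fun x => |x - a| * f' x) volume a 1 :=
    hi'.mono_set (uIcc_subset_uIcc_right ha')
  rw [← intervalIntegral.integral_add_adjacent_intervals hl hr,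
    integral_eq_of_hasDerivAt_off_countable_of_le (fun x => (a - x) * f x + F x) _ ha.1
      countable_empty (by fun_prop) (fun x hx => ?_) hl,
    integral_eq_of_hasDerivAt_off_countable_of_le (fun x => (x - a) * f x - F x) _ ha.2
      countable_empty (by fun_prop) (fun x hx => ?_) hr]
  · simp only [h₁, h₂]
    ring
  · have hx' := hx.1
    have h := (((hasDerivAt_id x).sub_const a).mul (hd x ⟨ha.1.trans_lt hx'.1, hx'.2⟩)).sub (hF x)
    refine h.congr_deriv ?_
    rw [abs_of_nonneg (sub_nonneg.2 hx'.1.le)]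
    simp
  · have hx' := hx.1
    have h := (((hasDerivAt_id x).const_sub a).mul (hd x ⟨hx'.1, hx'.2.trans_le ha.2⟩)).add (hF x)
    refine h.congr_deriv ?_
    rw [abs_of_nonpos (sub_nonpos.2 hx'.2.le)]
    simp

theorem integral_eq_zero_of_hasDerivAt (hf : Continuous f)
    (hd : ∀ x ∈ Ioo (-1 : ℝ) 1, HasDerivAt f (f' x) x) (hi : IntervalIntegrable f' volume (-1) 1)
    (h₁ : f (-1) = 0) (h₂ : f 1 = 0) : ∫ x in (-1 : ℝ)..1, f' x = 0 := by
  rw [integral_eq_of_hasDerivAt_off_countable_of_le f f' (by norm_num) countable_empty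
    hf.continuousOn (fun x hx => hd x hx.1) hi, h₁, h₂, sub_zero]

theorem integral_absData_mul (hF : ∀ x, HasDerivAt F (f x) x) (hf : Continuous f)
    (hd : ∀ x ∈ Ioo (-1 : ℝ) 1, HasDerivAt f (f' x) x) (hi : IntervalIntegrable f' volume (-1) 1)
    (h₁ : f (-1) = 0) (h₂ : f 1 = 0) :
    ∫ x, absData x * f' x ∂leb = 2 * F 0 - F 1 - F (-1) := by
  have h := integral_abs_sub_mul (a := 0) (by norm_num) hF hf hd hi h₁ h₂
  have hi' : IntervalIntegrable (fun x => |x| * f' x) volume (-1) 1 :=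
    hi.continuousOn_mul (by fun_prop)
  simp only [sub_zero] at h
  rw [integral_leb]
  simp only [absData, sub_mul]
  rw [intervalIntegral.integral_sub hi' (hi.const_mul _), h, intervalIntegral.integral_const_mul,
    integral_eq_zero_of_hasDerivAt hf hd hi h₁ h₂, mul_zero, sub_zero]

/-- The clip is a constant plus half a signed sum of four functions `|x - a|`, with kinks at `±c`
and `±(1 - c)`; the constant pairs to zero. -/
theorem integral_clippedAbs_mul {c : ℝ} (hc : c ∈ Icc (0 : ℝ) (1 / 2))
    (hF : ∀ x, HasDerivAt F (f x) x) (hf : Continuous f)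
    (hd : ∀ x ∈ Ioo (-1 : ℝ) 1, HasDerivAt f (f' x) x) (hi : IntervalIntegrable f' volume (-1) 1)
    (h₁ : f (-1) = 0) (h₂ : f 1 = 0) :
    ∫ x, clippedAbs c x * f' x ∂leb = F c + F (-c) - F (1 - c) - F (-1 + c) := by
  obtain ⟨hc0, hc1⟩ := hc
  have h := fun a ha => integral_abs_sub_mul (a := a) ha hF hf hd hi h₁ h₂
  have hi' : ∀ a, IntervalIntegrable (fun x => |x - a| * f' x) volume (-1) 1 := fun a =>
    hi.continuousOn_mul (by fun_prop)
  have e : ∀ x, clippedAbs c x * f' x = (1 / 2 - c) * f' x + 1 / 2 * (|x - -c| * f' x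
      + |x - c| * f' x - |x - (-1 + c)| * f' x - |x - (1 - c)| * f' x) := fun x => by
    rw [clippedAbs, sub_neg_eq_add, show x - (-1 + c) = x + 1 - c by ring,
      show x - (1 - c) = x - 1 + c by ring]
    ring
  rw [integral_leb]
  simp only [e]
  rw [intervalIntegral.integral_add (hi.const_mul _)
      (((((hi' _).add (hi' _)).sub (hi' _)).sub (hi' _)).const_mul _),
    intervalIntegral.integral_const_mul, intervalIntegral.integral_const_mul,
    intervalIntegral.integral_sub (((hi' _).add (hi' _)).sub (hi' _)) (hi' _),
    intervalIntegral.integral_sub ((hi' _).add (hi' _)) (hi' _),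
    intervalIntegral.integral_add (hi' _) (hi' _),
    integral_eq_zero_of_hasDerivAt hf hd hi h₁ h₂, h _ ⟨by linarith, by linarith⟩,
    h _ ⟨by linarith, by linarith⟩, h _ ⟨by linarith, by linarith⟩, h _ ⟨by linarith, by linarith⟩]
  ring

end Kinks

theorem notMem_pair_of_mem_Ioo {x : ℝ} (hx : x ∈ Ioo (-1 : ℝ) 1) : x ∉ ({-1, 1} : Set ℝ) := by
  rintro (rfl | rfl)
  · exact lt_irrefl _ hx.1
  · exact lt_irrefl _ hx.2

theorem integral_clippedAbs_mul_residual {c : ℝ} (hc : c ∈ Icc (0 : ℝ) (1 / 2)) :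
    ∫ x, clippedAbs c x * residual c x ∂leb = 2 * (1 - 2 * c) * (c ^ 2 / 2) := by
  rw [integral_clippedAbs_mul hc (hasDerivAt_residualPrim₂ c) (continuous_residualPrim c)
    (fun x hx => hasDerivAt_residualPrim hc (notMem_pair_of_mem_Ioo hx))
    (intervalIntegrable_residual hc _ _) (residualPrim_eq_zero hc (Or.inl le_rfl))
    (residualPrim_eq_zero hc (Or.inr le_rfl)), residualPrim₂_kinks hc]

theorem integral_absData_mul_residual {c : ℝ} (hc : c ∈ Icc (0 : ℝ) (1 / 2)) :
    ∫ x, absData x * residual c x ∂leb = 2 * (c ^ 2 / 2 - c ^ 3 / 3) := by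
  rw [integral_absData_mul (hasDerivAt_residualPrim₂ c) (continuous_residualPrim c)
    (fun x hx => hasDerivAt_residualPrim hc (notMem_pair_of_mem_Ioo hx))
    (intervalIntegrable_residual hc _ _) (residualPrim_eq_zero hc (Or.inl le_rfl))
    (residualPrim_eq_zero hc (Or.inr le_rfl)), residualPrim₂_zero hc,
    residualPrim₂_eq_zero hc (Or.inl le_rfl), residualPrim₂_eq_zero hc (Or.inr le_rfl)]
  ring

section TestFunctions

variable {φ : ℝ → ℝ}

theorem testFunctions_eq_zero (h : φ ∈ testFunctions) {x : ℝ} (hx : x ∉ Ioo (-1 : ℝ) 1) :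
    φ x = 0 :=
  image_eq_zero_of_notMem_tsupport fun hx' => hx (h.2.2 hx')

theorem testFunctions_hasDerivAt (h : φ ∈ testFunctions) (x : ℝ) :
    HasDerivAt φ (deriv φ x) x :=
  (h.1.differentiable (by simp) x).hasDerivAt

/-- The kinks pair off into two intervals of length `1 - 2c`, over each of which a primitive of `φ`
changes by at most `l` times the length. -/
theorem integral_clippedAbs_mul_deriv_le {c l : ℝ} (hc : c ∈ Icc (0 : ℝ) (1 / 2))
    (h : φ ∈ testFunctions) (hl : ∀ x, |φ x| ≤ l) :
    ∫ x, clippedAbs c x * deriv φ x ∂leb ≤ 2 * (1 - 2 * c) * l := by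
  have hφ : Continuous φ := h.1.continuous
  set F : ℝ → ℝ := fun x => ∫ t in (-1 : ℝ)..x, φ t
  have hF : ∀ x, HasDerivAt F (φ x) x := fun x =>
    (hφ.integral_hasStrictDerivAt (-1) x).hasDerivAt
  rw [integral_clippedAbs_mul hc hF hφ (fun x _ => testFunctions_hasDerivAt h x)
    ((deriv_mem_testFunctions h).1.continuous.intervalIntegrable _ _)
    (testFunctions_eq_zero h (by simp)) (testFunctions_eq_zero h (by simp))]
  have hb : ∀ a b, F a - F b ≤ l * |a - b| := fun a b =>
    (le_abs_self _).trans (convex_univ.norm_image_sub_le_of_norm_hasDerivWithin_le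
      (fun x _ => (hF x).hasDerivWithinAt) (fun x _ => hl x) (mem_univ b) (mem_univ a))
  have h1 := hb c (1 - c)
  have h2 := hb (-c) (-1 + c)
  rw [abs_of_nonpos (by linarith [hc.2])] at h1
  rw [abs_of_nonneg (by linarith [hc.2])] at h2
  linarith

theorem integral_absData_mul_deriv_deriv (h : φ ∈ testFunctions) :
    ∫ x, absData x * deriv (deriv φ) x ∂leb = 2 * φ 0 := by
  have h' := deriv_mem_testFunctions h
  rw [integral_absData_mul (testFunctions_hasDerivAt h) h'.1.continuous
    (fun x _ => testFunctions_hasDerivAt h' x)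
    ((deriv_mem_testFunctions h').1.continuous.intervalIntegrable _ _)
    (testFunctions_eq_zero h' (by simp)) (testFunctions_eq_zero h' (by simp)),
    testFunctions_eq_zero h (by simp : (1 : ℝ) ∉ Ioo (-1 : ℝ) 1),
    testFunctions_eq_zero h (by simp : (-1 : ℝ) ∉ Ioo (-1 : ℝ) 1)]
  ring

end TestFunctions

/-! ### The dual certificate for minimizers. -/

/-- A dual certificate characterizes the unique minimizer of a fidelity plus a regularizer. -/
theorem isMinOn_fidelity_add_iff {J : L2 → EReal} {g : ℝ → ℝ} (hg : MemLp g 2 leb) {u : L2}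
    (h₁ : ∀ v : L2, ((∫ x, v x * (g x - u x) ∂leb : ℝ) : EReal) ≤ J v)
    (h₂ : J u ≤ ((∫ x, u x * (g x - u x) ∂leb : ℝ) : EReal)) (v : L2) :
    IsMinOn (fun v => (fidelity g v : EReal) + J v) univ v ↔ v = u := by
  have hu := Lp.memLp u
  have hJu : J u = ((∫ x, u x * (g x - u x) ∂leb : ℝ) : EReal) := le_antisymm h₂ (h₁ u)
  -- Completing the square: `½(v-g)² + v(g-u) = ½(u-g)² + u(g-u) + ½(v-u)²` pointwise.
  have key : ∀ v : L2, fidelity g v + ∫ x, v x * (g x - u x) ∂leb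
      = fidelity g u + ∫ x, u x * (g x - u x) ∂leb + 1 / 2 * ∫ x, (v x - u x) ^ 2 ∂leb := by
    intro v
    have hv := Lp.memLp v
    have i1 : Integrable (fun x => (v x - g x) ^ 2) leb := (hv.sub hg).integrable_sq
    have i2 : Integrable (fun x => (u x - g x) ^ 2) leb := (hu.sub hg).integrable_sq
    have i3 : Integrable (fun x => (v x - u x) ^ 2) leb := (hv.sub hu).integrable_sq
    have i4 : Integrable (fun x => v x * (g x - u x)) leb := hv.integrable_mul (hg.sub hu)
    have i5 : Integrable (fun x => u x * (g x - u x)) leb := hu.integrable_mul (hg.sub hu)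
    unfold fidelity
    rw [← integral_const_mul, ← integral_const_mul, ← integral_const_mul,
      ← integral_add (i1.const_mul _) i4, ← integral_add (i2.const_mul _) i5,
      ← integral_add (f := fun x => 1 / 2 * (u x - g x) ^ 2 + u x * (g x - u x))
        ((i2.const_mul _).add i5) (i3.const_mul _)]
    refine integral_congr_ae (.of_forall fun x => ?_)
    ring
  have lower : ∀ v : L2, ((fidelity g u + ∫ x, u x * (g x - u x) ∂leb
      + 1 / 2 * ∫ x, (v x - u x) ^ 2 ∂leb : ℝ) : EReal) ≤ (fidelity g v : EReal) + J v := fun v => by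
    rw [← key, EReal.coe_add]
    exact add_le_add le_rfl (h₁ v)
  have hnn : ∀ v : L2, 0 ≤ ∫ x, (v x - u x) ^ 2 ∂leb := fun v =>
    integral_nonneg fun x => sq_nonneg _
  constructor
  · intro hmin
    have h := (lower v).trans (isMinOn_iff.1 hmin u (mem_univ u))
    simp only [hJu] at h
    rw [← EReal.coe_add, EReal.coe_le_coe_iff] at h
    have h0 : ∫ x, (v x - u x) ^ 2 ∂leb = 0 := le_antisymm (by linarith) (hnn v)
    have hi : Integrable (fun x => (v x - u x) ^ 2) leb := ((Lp.memLp v).sub hu).integrable_sq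
    rw [integral_eq_zero_iff_of_nonneg (fun x => sq_nonneg _) hi] at h0
    refine Lp.ext ?_
    filter_upwards [h0] with x hx
    exact sub_eq_zero.1 (pow_eq_zero_iff two_ne_zero |>.1 hx)
  · rintro rfl
    refine isMinOn_iff.2 fun z _ => le_trans ?_ (lower z)
    simp only [hJu]
    rw [← EReal.coe_add, EReal.coe_le_coe_iff]
    linarith [hnn z]

theorem memLp_of_continuous {f : ℝ → ℝ} (hf : Continuous f) : MemLp f 2 leb := by
  obtain ⟨M, hM⟩ := isCompact_Icc.exists_bound_of_continuousOn (s := Icc (-1 : ℝ) 1)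
    hf.continuousOn
  refine MemLp.of_bound hf.aestronglyMeasurable M ?_
  filter_upwards [ae_restrict_mem measurableSet_Ioo] with x hx
  exact hM x (Ioo_subset_Icc_self hx)

theorem integral_toLp_mul {f : ℝ → ℝ} (hf : MemLp f 2 leb) (h : ℝ → ℝ) :
    ∫ x, hf.toLp f x * h x ∂leb = ∫ x, f x * h x ∂leb := by
  refine integral_congr_ae ?_
  filter_upwards [hf.coeFn_toLp] with x hx
  rw [hx]

theorem isMinOn_fidelity_add_iff_toLp {J : L2 → EReal} {f p : ℝ → ℝ} (hf : MemLp f 2 leb)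
    (hp : ∀ x ∈ Ioo (-1 : ℝ) 1, absData x - f x = p x)
    (h₁ : ∀ v : L2, ((∫ x, v x * p x ∂leb : ℝ) : EReal) ≤ J v)
    (h₂ : J hf.toLp ≤ ((∫ x, f x * p x ∂leb : ℝ) : EReal)) (v : L2) :
    IsMinOn (fun v => (fidelity absData v : EReal) + J v) univ v ↔ v = hf.toLp := by
  have e : ∀ v : L2, ∫ x, v x * (absData x - hf.toLp f x) ∂leb = ∫ x, v x * p x ∂leb := fun v => by
    refine integral_congr_ae ?_
    filter_upwards [hf.coeFn_toLp, ae_restrict_mem measurableSet_Ioo] with x hx hx'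
    rw [hx, hp x hx']
  refine isMinOn_fidelity_add_iff (memLp_of_continuous continuous_absData) (fun v => ?_) ?_ v
  · rw [e]
    exact h₁ v
  · rwa [e, integral_toLp_mul]

theorem absData_sub_clippedAbs (c : ℝ) {x : ℝ} (hx : x ∈ Ioo (-1 : ℝ) 1) :
    absData x - clippedAbs c x = residual c x := by
  rw [residual, indicator_of_mem hx]

theorem clippedAbs_half (x : ℝ) : clippedAbs (1 / 2) x = 0 := by
  rw [clippedAbs, show x + 1 - 1 / 2 = x + 1 / 2 by ring, show x - 1 + 1 / 2 = x - 1 / 2 by ring]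
  ring

theorem absData_eq_residual_half {x : ℝ} (hx : x ∈ Ioo (-1 : ℝ) 1) :
    absData x = residual (1 / 2) x := by
  rw [← absData_sub_clippedAbs _ hx, clippedAbs_half, sub_zero]

/-! ### Explicit minimizers of the three functionals. -/

/-- The minimizers of the `TV¹` functional are clipped data. -/
theorem isMinOn_tvFunctional_one_iff {c l : ℝ} (hc : c ∈ Icc (0 : ℝ) (1 / 2))
    (hl : c ^ 2 / 2 ≤ l) (h : (1 - 2 * c) * (l - c ^ 2 / 2) = 0) (v : L2) :
    IsMinOn (tvFunctional absData 1 l) univ v ↔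
      v = (memLp_of_continuous (continuous_clippedAbs c)).toLp := by
  refine isMinOn_fidelity_add_iff_toLp _ (fun x hx => absData_sub_clippedAbs c hx)
    (integral_mul_residual_le_tv_one hc hl) (iSup₂_le fun φ hφ => ?_) v
  -- The hypothesis `h` is complementary slackness: `l` is tight unless `c = 1/2`, where the
  -- minimizer is zero. It makes the two pairings meet.
  rw [integral_toLp_mul, EReal.coe_le_coe_iff, integral_clippedAbs_mul_residual hc,
    iteratedDeriv_one]
  linarith [integral_clippedAbs_mul_deriv_le hc hφ.1 hφ.2]

/-- The minimizers of the `TV²` functional are multiples of the data. -/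
theorem isMinOn_tvFunctional_two_iff {d l : ℝ} (hd : d ∈ Icc (0 : ℝ) 1)
    (hl : (1 - d) / 12 ≤ l) (h : d * (l - (1 - d) / 12) = 0) (v : L2) :
    IsMinOn (tvFunctional absData 2 l) univ v ↔
      v = (memLp_of_continuous (continuous_absData.const_mul d)).toLp := by
  -- At `c = 1/2` the bound `c²/2 - c³/3` is `1/12`, the constant in the hypotheses.
  have hc : (1 / 2 : ℝ) ∈ Icc (0 : ℝ) (1 / 2) := by norm_num
  refine isMinOn_fidelity_add_iff_toLp (p := fun x => (1 - d) * residual (1 / 2) x) _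
    (fun x hx => ?_)
    (integral_mul_residual_le_tv_two hc (sub_nonneg.2 hd.2) (le_trans (by linarith) hl))
    (iSup₂_le fun φ hφ => ?_) v
  · rw [← absData_eq_residual_half hx]
    ring
  · have e : ∀ x, d * absData x * ((1 - d) * residual (1 / 2) x)
        = d * (1 - d) * (absData x * residual (1 / 2) x) := fun x => by ring
    rw [integral_toLp_mul, EReal.coe_le_coe_iff, iteratedDeriv_succ, iteratedDeriv_one]
    simp only [e, mul_assoc d (absData _)]
    rw [integral_const_mul, integral_const_mul, integral_absData_mul_residual hc,
      integral_absData_mul_deriv_deriv hφ.1]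
    have h0 := mul_le_mul_of_nonneg_left ((le_abs_self _).trans (hφ.2 0)) hd.1
    linarith

theorem continuous_w {c : ℝ} (hc : c ∈ Icc (0 : ℝ) (1 / 2)) (d : ℝ) :
    Continuous fun x => w x c d := by
  simp only [w_eq hc]
  exact ((continuous_clippedAbs c).const_mul _).add (continuous_absData.const_mul d)

/-- The family `w` consists of minimizers of `TGV` functionals. -/
theorem isMinOn_tgvFunctional_iff {c d l₁ l₂ : ℝ} (hc : c ∈ Icc (0 : ℝ) (1 / 2))
    (hd : d ∈ Icc (0 : ℝ) 1) (h₁ : (1 - d) * (c ^ 2 / 2) = l₁)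
    (h₂ : (1 - d) * (c ^ 2 / 2 - c ^ 3 / 3) = l₂) (v : L2) :
    IsMinOn (tgvFunctional absData l₁ l₂) univ v ↔
      v = (memLp_of_continuous (continuous_w hc d)).toLp := by
  have hd' : 0 ≤ 1 - d := sub_nonneg.2 hd.2
  have split : ∀ (M : ℝ) (f : ℝ → ℝ), AEStronglyMeasurable f leb → (∀ᵐ x ∂leb, ‖f x‖ ≤ M) →
      ∫ x, w x c d * f x ∂leb
        = (1 - d) * ∫ x, clippedAbs c x * f x ∂leb + d * ∫ x, absData x * f x ∂leb := by
    intro M f hf hM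
    have i1 : Integrable (fun x => clippedAbs c x * f x) leb :=
      ((memLp_of_continuous (continuous_clippedAbs c)).integrable (by norm_num)).mul_bdd hf hM
    have i2 : Integrable (fun x => absData x * f x) leb :=
      ((memLp_of_continuous continuous_absData).integrable (by norm_num)).mul_bdd hf hM
    rw [← integral_const_mul, ← integral_const_mul,
      ← integral_add (i1.const_mul _) (i2.const_mul _)]
    refine integral_congr_ae (.of_forall fun x => ?_)
    simp only [w_eq hc]
    ring
  refine isMinOn_fidelity_add_iff_toLp (p := fun x => (1 - d) * residual c x) _
    (fun x hx => ?_) (integral_mul_residual_le_tgv hc hd' h₁.le h₂.le) (iSup₂_le fun φ hφ => ?_) v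
  · rw [w_eq hc, ← absData_sub_clippedAbs c hx]
    ring
  · have e : ∀ x, w x c d * ((1 - d) * residual c x) = (1 - d) * (w x c d * residual c x) :=
      fun x => by ring
    have hφ' := deriv_mem_testFunctions hφ.1
    have hφ2 := deriv_mem_testFunctions hφ'
    obtain ⟨M, hM⟩ := hφ2.1.continuous.bounded_above_of_compact_support hφ2.2.1
    rw [integral_toLp_mul, EReal.coe_le_coe_iff, iteratedDeriv_succ, iteratedDeriv_one,
      split M _ hφ2.1.continuous.aestronglyMeasurable (.of_forall hM),
      integral_absData_mul_deriv_deriv hφ.1]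
    simp only [e]
    rw [integral_const_mul, split c _ (measurable_residual c).aestronglyMeasurable
      (.of_forall (abs_residual_le hc)), integral_clippedAbs_mul_residual hc,
      integral_absData_mul_residual hc]
    -- The clip part is controlled by the bound on `φ'`, the `u^δ` part by the bound on `φ` at the
    -- origin alone.
    have h3 := mul_le_mul_of_nonneg_left (integral_clippedAbs_mul_deriv_le hc hφ' hφ.2.1) hd'
    have h4 := mul_le_mul_of_nonneg_left ((le_abs_self _).trans (hφ.2.2 0)) hd.1
    rw [← h₁] at h3
    rw [← h₂] at h4
    linarith

/-! ### Dual norms of the TV minimizers and the region `Λ`. -/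

section Sigma

variable {c k : ℝ} {f : ℝ → ℝ}

theorem sigma_one_toLp_sub (hc : c ∈ Icc (0 : ℝ) (1 / 2)) (hf : MemLp f 2 leb)
    (h : ∀ x ∈ Ioo (-1 : ℝ) 1, absData x - f x = k * residual c x) {x : ℝ}
    (hx : x ∈ Ioo (-1 : ℝ) 1) :
    sigma 1 (fun x => hf.toLp f x - absData x) x = -k * residualPrim c x := by
  have e : ∫ t in (-1 : ℝ)..x, (hf.toLp f t - absData t) = ∫ t in (-1 : ℝ)..x, -k * residual c t := by
    refine intervalIntegral.integral_congr_ae ?_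
    filter_upwards [(ae_restrict_iff' measurableSet_Ioo).1 hf.coeFn_toLp] with t ht ht'
    rw [uIoc_of_le hx.1.le] at ht'
    have hm : t ∈ Ioo (-1 : ℝ) 1 := ⟨ht'.1, ht'.2.trans_lt hx.2⟩
    rw [ht hm]
    linarith [h t hm]
  rw [sigma]
  simp only [sigma]
  rw [e, intervalIntegral.integral_const_mul, integral_residual hc,
    residualPrim_eq_zero hc (Or.inl le_rfl), sub_zero]

theorem sigma_two_toLp_sub (hc : c ∈ Icc (0 : ℝ) (1 / 2)) (hf : MemLp f 2 leb)
    (h : ∀ x ∈ Ioo (-1 : ℝ) 1, absData x - f x = k * residual c x) {x : ℝ}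
    (hx : x ∈ Ioo (-1 : ℝ) 1) :
    sigma 2 (fun x => hf.toLp f x - absData x) x = -k * residualPrim₂ c x := by
  have e : ∫ t in (-1 : ℝ)..x, sigma 1 (fun x => hf.toLp f x - absData x) t
      = ∫ t in (-1 : ℝ)..x, -k * residualPrim c t := by
    refine intervalIntegral.integral_congr_ae (.of_forall fun t ht' => ?_)
    rw [uIoc_of_le hx.1.le] at ht'
    exact sigma_one_toLp_sub hc hf h ⟨ht'.1, ht'.2.trans_lt hx.2⟩
  rw [sigma]
  beta_reduce
  rw [e, intervalIntegral.integral_const_mul,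
    intervalIntegral.integral_eq_sub_of_hasDerivAt (fun t _ => hasDerivAt_residualPrim₂ c t)
      ((continuous_residualPrim c).intervalIntegrable _ _),
    residualPrim₂_eq_zero hc (Or.inl le_rfl), sub_zero]

theorem dualSigmaNorm_one_toLp_le (hc : c ∈ Icc (0 : ℝ) (1 / 2)) (hk : 0 ≤ k)
    (hf : MemLp f 2 leb) (h : ∀ x ∈ Ioo (-1 : ℝ) 1, absData x - f x = k * residual c x) :
    dualSigmaNorm absData 1 hf.toLp ≤ ENNReal.ofReal (k * (c ^ 2 / 2)) := by
  rw [dualSigmaNorm, eLpNorm_exponent_top]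
  refine eLpNormEssSup_le_of_ae_bound ?_
  filter_upwards [ae_restrict_mem measurableSet_Ioo] with x hx
  rw [sigma_one_toLp_sub hc hf h hx, norm_mul, norm_neg, Real.norm_of_nonneg hk]
  exact mul_le_mul_of_nonneg_left (abs_residualPrim_le hc x) hk

theorem dualSigmaNorm_two_toLp_le (hc : c ∈ Icc (0 : ℝ) (1 / 2)) (hk : 0 ≤ k)
    (hf : MemLp f 2 leb) (h : ∀ x ∈ Ioo (-1 : ℝ) 1, absData x - f x = k * residual c x) :
    dualSigmaNorm absData 2 hf.toLp ≤ ENNReal.ofReal (k * (c ^ 2 / 2 - c ^ 3 / 3)) := by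
  rw [dualSigmaNorm, eLpNorm_exponent_top]
  refine eLpNormEssSup_le_of_ae_bound ?_
  filter_upwards [ae_restrict_mem measurableSet_Ioo] with x hx
  rw [sigma_two_toLp_sub hc hf h hx, norm_mul, norm_neg, Real.norm_of_nonneg hk]
  exact mul_le_mul_of_nonneg_left (abs_residualPrim₂_le hc x) hk

end Sigma

theorem lt_of_ofReal_lt {a b : ℝ} {x : ℝ≥0∞} (h : ENNReal.ofReal a < x)
    (h' : x ≤ ENNReal.ofReal b) : a < b :=
  lt_of_not_ge fun hba => (h.trans_le h').not_ge (ENNReal.ofReal_le_ofReal hba)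

/-- Uniqueness identifies `u` with the clip, so its dual norm is bounded by that of the second
primitive. -/
theorem lt_of_isMinOn_tv_one {c l m : ℝ} (hc : c ∈ Icc (0 : ℝ) (1 / 2)) (hl : c ^ 2 / 2 ≤ l)
    (h : (1 - 2 * c) * (l - c ^ 2 / 2) = 0) {u : L2}
    (hu : IsMinOn (tvFunctional absData 1 l) univ u)
    (hm : ENNReal.ofReal m < dualSigmaNorm absData 2 u) : m < c ^ 2 / 2 - c ^ 3 / 3 := by
  rw [isMinOn_tvFunctional_one_iff hc hl h] at hu
  subst hu
  have h' := lt_of_ofReal_lt hm (dualSigmaNorm_two_toLp_le (k := 1) hc zero_le_one _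
    fun x hx => by rw [absData_sub_clippedAbs c hx, one_mul])
  rwa [one_mul] at h'

/-- Here `u` is `(1 - 12 l) u^δ`, whose residual is `12 l` times the one at `c = 1/2`; its first
primitive is bounded by `12 l / 8`. -/
theorem lt_of_isMinOn_tv_two {l m : ℝ} (hl0 : 0 < l) (hl : l < 1 / 12) {u : L2}
    (hu : IsMinOn (tvFunctional absData 2 l) univ u)
    (hm : ENNReal.ofReal m < dualSigmaNorm absData 1 u) : m < 3 / 2 * l := by
  have hd : 1 - 12 * l ∈ Icc (0 : ℝ) 1 := ⟨by linarith, by linarith⟩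
  rw [isMinOn_tvFunctional_two_iff hd (by linarith) (by ring)] at hu
  subst hu
  have h' := lt_of_ofReal_lt hm (dualSigmaNorm_one_toLp_le (c := 1 / 2) (k := 12 * l)
    (by norm_num) (by positivity) _ fun x hx => by
      rw [← absData_eq_residual_half hx]; ring)
  linarith

/-- The inequalities that describe the region `Λ` for the data `|x| - 1/2`. -/
theorem exists_of_mem_Lambda {l₁ l₂ : ℝ} (h : (l₁, l₂) ∈ Lambda absData) :
    ∃ s : ℝ, 0 < s ∧ s < 1 / 2 ∧ l₁ = s ^ 2 / 2 ∧ 0 < l₂ ∧ l₂ < s ^ 2 / 2 - s ^ 3 / 3 ∧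
      l₁ < 3 / 2 * l₂ := by
  obtain ⟨h1, h2, u₁, u₂, hu₁, hu₂, hm₁, hm₂⟩ := h
  simp only at h1 h2 hu₁ hu₂ hm₁ hm₂
  by_cases hl : 1 / 8 ≤ l₁
  -- For `l₁ ≥ 1/8` the `TV¹` minimizer is zero, which forces `l₂ < 1/12` and then `l₁ < 1/8`, a
  -- contradiction.
  · have h3 := lt_of_isMinOn_tv_one (c := 1 / 2) (by norm_num) (by linarith) (by ring) hu₁ hm₂
    have h4 := lt_of_isMinOn_tv_two h2 (by linarith) hu₂ hm₁
    linarith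
  · push Not at hl
    have hs : √(2 * l₁) ^ 2 = 2 * l₁ := Real.sq_sqrt (by linarith)
    have hs0 : 0 < √(2 * l₁) := Real.sqrt_pos.2 (by linarith)
    set s := √(2 * l₁)
    have hs1 : s < 1 / 2 := by nlinarith
    have e : l₁ = s ^ 2 / 2 := by linarith
    have h3 := lt_of_isMinOn_tv_one ⟨hs0.le, hs1.le⟩ e.ge (by rw [e]; ring) hu₁ hm₂
    have h5 : s ^ 2 / 2 - s ^ 3 / 3 ≤ 1 / 12 := by
      nlinarith [mul_nonneg (sq_nonneg (1 / 2 - s)) hs0.le, sq_nonneg (1 / 2 - s)]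
    exact ⟨s, hs0, hs1, e, h2, h3, lt_of_isMinOn_tv_two h2 (by linarith) hu₂ hm₁⟩

end TGV

/-! ### The parameters of the theorem. -/

theorem mainTheorem2 (l₁ l₂ : ℝ) (hl : (l₁, l₂) ∈ TGV.Lambda TGV.absData)
    (c d m₁ m₂ : ℝ)
    (hc : c = 3 * (l₁ - l₂) / (2 * l₁))
    (hd : d = 1 - 8 / 9 * (l₁ ^ 3 / (l₂ - l₁) ^ 2))
    (hm₁ : m₁ = 9 / 8 * ((l₁ - l₂) ^ 2 / l₁ ^ 2))
    (hm₂ : m₂ = 2 / 27 * (l₁ ^ 3 / (l₁ - l₂) ^ 2)) :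
    c ∈ Set.Icc (0 : ℝ) (1 / 2) ∧ d ∈ Set.Icc (0 : ℝ) 1 ∧
    m₁ ∈ Set.Ioc (0 : ℝ) (1 / 8) ∧ m₂ ∈ Set.Ioc (0 : ℝ) (1 / 12) ∧
    ∃ hw : MeasureTheory.MemLp (fun x => TGV.w x c d) 2 TGV.leb,
      -- the function `w(·, c, d)` is the unique minimizer of the TGV functional
      (∀ u : TGV.L2,
        IsMinOn (TGV.tgvFunctional TGV.absData l₁ l₂) Set.univ u ↔ u = hw.toLp) ∧
      -- it is a weighted sum of the TV minimizer and the TV² minimizer with parameters `m₁, m₂`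
      ∃ v₁ v₂ : TGV.L2,
        (∀ v : TGV.L2, IsMinOn (TGV.tvFunctional TGV.absData 1 m₁) Set.univ v ↔ v = v₁) ∧
        (∀ v : TGV.L2, IsMinOn (TGV.tvFunctional TGV.absData 2 m₂) Set.univ v ↔ v = v₂) ∧
        hw.toLp = (12 * m₂) • v₁ + v₂ := by
  obtain ⟨s, hs0, hs1, hls, hl2, hlt, hlt'⟩ := TGV.exists_of_mem_Lambda hl
  have hl1 : 0 < l₁ := by rw [hls]; positivity
  have hs3 : 0 < s ^ 3 := by positivity
  have hsub : 0 < l₁ - l₂ := by linarith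
  have hcl : c * (2 * l₁) = 3 * (l₁ - l₂) := by rw [hc]; field_simp
  -- With `l₁ = s²/2`, this is exactly `l₂ < s²/2 - s³/3`.
  have hsc : s < c := by
    rw [hc, lt_div_iff₀ (by positivity)]
    rw [hls] at hsub ⊢
    nlinarith
  have hc0 : 0 < c := hs0.trans hsc
  have hc' : c ∈ Set.Icc (0 : ℝ) (1 / 2) := by
    refine ⟨hc0.le, ?_⟩
    rw [hc, div_le_iff₀ (by positivity)]
    linarith
  have hd2 : (1 - d) * (c ^ 2 / 2) = l₁ := by
    rw [hd, hc, show (l₂ - l₁) ^ 2 = (l₁ - l₂) ^ 2 by ring]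
    field_simp
    ring
  have hd0 : 0 < 1 - d := by
    by_contra! h
    have := mul_nonneg (neg_nonneg.2 h) (by positivity : 0 ≤ c ^ 2 / 2)
    linarith
  have hd' : d ∈ Set.Icc (0 : ℝ) 1 := by
    refine ⟨?_, by linarith⟩
    -- A negative `d` would give `l₁ > c²/2 > s²/2`.
    by_contra! h
    nlinarith [mul_pos (neg_pos.2 h) (by positivity : 0 < c ^ 2 / 2)]
  have hm₁' : m₁ = c ^ 2 / 2 := by
    rw [hm₁, hc]; field_simp; ring
  have hm₂' : m₂ = (1 - d) / 12 := by
    rw [hm₂, hd, show (l₂ - l₁) ^ 2 = (l₁ - l₂) ^ 2 by ring]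
    ring
  have hd3 : (1 - d) * (c ^ 2 / 2 - c ^ 3 / 3) = l₂ := by
    linear_combination (1 - 2 * c / 3) * hd2 - hcl / 3
  refine ⟨hc', hd', ⟨by rw [hm₁']; positivity, ?_⟩, ⟨by rw [hm₂']; positivity, ?_⟩,
    TGV.memLp_of_continuous (TGV.continuous_w hc' d),
    TGV.isMinOn_tgvFunctional_iff hc' hd' hd2 hd3, _, _,
    TGV.isMinOn_tvFunctional_one_iff hc' hm₁'.ge (by rw [hm₁']; ring),
    TGV.isMinOn_tvFunctional_two_iff hd' hm₂'.ge (by rw [hm₂']; ring), ?_⟩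
  · rw [hm₁']; nlinarith [hc'.2]
  · rw [hm₂']; linarith [hd'.1]
  · rw [← MeasureTheory.MemLp.toLp_const_smul, ← MeasureTheory.MemLp.toLp_add]
    congr 1
    funext x
    rw [TGV.w_eq hc', hm₂']
    simp only [Pi.add_apply, Pi.smul_apply, smul_eq_mul]
    ring
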